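/- Let $n\ge 0$ be an integer and let $\mathscr P_n$ be the space of complex polynomials $P(z)=\sum_{j=0}^n a_jz^j$ of degree at most $n$. Let $B\in\mathcal B_n$, that is, $B$ is an operator on $\mathscr P_n$ of the form $$B[P](z)=\lambda_0P(z)+\lambda_1\Big(\frac{nz}{2}\Big)\frac{P'(z)}{1!}+\lambda_2\Big(\frac{nz}{2}\Big)^2\frac{P''(z)}{2!},$$ where $\lambda_0,\lambda_1,\lambda_2\in\mathbb C$ are such that all the zeros of $U(z)=\lambda_0+n\lambda_1z+\frac{n(n-1)}{2}\lambda_2z^2$ (which is thus not identically zero) lie in the half plane $|z|\le|z-n/2|$. Let $\alpha,\beta\in\mathbb C$ with $|\alpha|\le1$, $|\beta|\le1$, let $R>r\ge k>0$ be real, and put $\sigma(z)=Rz$, $\rho(z)=rz$ and $$\Phi_k=\Phi_k(R,r,\alpha,\beta)=\beta\Big\{\Big(\frac{R+k}{k+r}\Big)^n-|\alpha|\Big\}-\alpha.$$ Then for every $P\in\mathscr P_n$ and every $z$ with $|z|=1$, $$\big|B[P\circ\sigma](z)+\Phi_k\,B[P\circ\rho](z)\big|\le\frac1{k^n}\,\big|R^n+r^n\Phi_k\big|\,\big|B[z^n]\big|\,\max_{|w|=k}|P(w)|,$$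 where $B[z^n]$ is the value at $z$ of the image under $B$ of the $n$-th power monomial. Equality holds for $P(z)=az^n$ with any $a\ne0$, at every $z$ with $|z|=1$. Consequently the result is best possible: for each $z$ with $|z|=1$, the factor $k^{-n}|R^n+r^n\Phi_k||B[z^n]|$ cannot be replaced by any smaller number independent of $P\in\mathscr P_n$. -/

import Mathlib

open Polynomial

/-- The operator of Rahman type with parameters `l₀, l₁, l₂`:
`B[P](z) = l₀ P(z) + l₁ (n z / 2) P'(z) / 1! + l₂ (n z / 2)² P''(z) / 2!`. -/
noncomputable def rahmanOp (n : ℕ) (l₀ l₁ l₂ : ℂ) (P : ℂ[X]) : ℂ[X] :=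
  C l₀ * P + C l₁ * (C ((n : ℂ) / 2) * X) * derivative P
    + C l₂ * (C ((n : ℂ) / 2) * X) ^ 2 * (C (1 / 2) * derivative (derivative P))

/-- The characteristic polynomial `U(z) = l₀ + n l₁ z + (n (n - 1) / 2) l₂ z²`. -/
noncomputable def rahmanChar (n : ℕ) (l₀ l₁ l₂ : ℂ) (z : ℂ) : ℂ :=
  l₀ + (n : ℂ) * l₁ * z + (n : ℂ) * ((n : ℂ) - 1) / 2 * l₂ * z ^ 2

/-- The class `𝓑ₙ`: operators that on the polynomials of degree at most `n` are given by
`rahmanOp n l₀ l₁ l₂`, for some `l₀, l₁, l₂` such that all zeros of `U` lie in the half plane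
`|z| ≤ |z - n / 2|`. Values of `B` at polynomials of degree larger than `n` are irrelevant. -/
def rahmanClass (n : ℕ) : Set (ℂ[X] → ℂ[X]) :=
  {B | ∃ l₀ l₁ l₂ : ℂ,
    (∀ z : ℂ, rahmanChar n l₀ l₁ l₂ z = 0 → ‖z‖ ≤ ‖z - (n : ℂ) / 2‖) ∧
    ∀ P : ℂ[X], P.natDegree ≤ n → B P = rahmanOp n l₀ l₁ l₂ P}

/-- `P ∘ σ` where `σ(z) = t z`. -/
noncomputable def dilate (P : ℂ[X]) (t : ℝ) : ℂ[X] := P.comp (C (t : ℂ) * X)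

/-- `Φ_k(R, r, α, β) = β {((R + k) / (k + r))ⁿ - |α|} - α`. -/
noncomputable def bigPhi (n : ℕ) (k R r : ℝ) (α β : ℂ) : ℂ :=
  β * (((((R + k) / (k + r)) ^ n - ‖α‖ : ℝ)) : ℂ) - α

/-- `Max_{|z| = k} |P(z)|`. -/
noncomputable def maxModulus (P : ℂ[X]) (k : ℝ) : ℝ :=
  sSup ((fun z : ℂ => ‖P.eval z‖) '' Metric.sphere (0 : ℂ) k)

/-- The supremum in `maxModulus` is an attained maximum. -/
theorem isGreatest_maxModulus (P : ℂ[X]) {k : ℝ} (hk : 0 ≤ k) :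
    IsGreatest ((fun z : ℂ => ‖P.eval z‖) '' Metric.sphere (0 : ℂ) k) (maxModulus P k) :=
  ((isCompact_sphere (0 : ℂ) k).image (by fun_prop)).isGreatest_sSup
    ((NormedSpace.sphere_nonempty.mpr hk).image _)

/-! Suppose the bound fails at `z`. Let `T` be the left-hand quantity and `K` the corresponding
value for the monomial `X ^ n`. Then `μ = T / K` exceeds `maxModulus P k / k ^ n` in norm, so `H = P
- μ X ^ n` has exact degree `n` and all its zeros in `|w| < k`. By `norm_eval_dilated_lt` and
`norm_bigPhi_le`, `G = H(R·) + Φ H(r·)` has degree `n` and all its zeros in the open unit disc. By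
`eval_rahmanOp_ne_zero`, `B[G](z) ≠ 0`, yet `B[G](z) = T - μ K = 0`. That non-vanishing is
Grace–Walsh–Szegő: over roots `w i`, `B[Q](z) / Q(z)` is a symmetric multiaffine form in the points
`z / (z - w i)`, whose diagonal is `U` rescaled. -/

/-! ### Coincidence in a half plane, degree at most two -/

theorem two_mul_re_mul_re_le (a b : ℂ) : 2 * (a.re * b.re) ≤ ‖a * b‖ + (a * b).re := by
  have h := Complex.re_le_norm (a * (starRingEnd ℂ) b)
  rw [norm_mul, Complex.norm_conj, ← norm_mul] at h
  simp only [Complex.mul_re, Complex.conj_re, Complex.conj_im] at h ⊢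
  linarith

theorem norm_sq_add_re_sq (a : ℂ) : ‖a ^ 2‖ + (a ^ 2).re = 2 * a.re ^ 2 := by
  rw [norm_pow, Complex.sq_norm, Complex.normSq_apply, pow_two a, Complex.mul_re]
  ring

theorem exists_quadratic_factorization {a b d : ℂ} (hd : d ≠ 0) :
    ∃ p q : ℂ, ∀ z : ℂ, a + b * z + d * z ^ 2 = d * ((z - p) * (z - q)) := by
  obtain ⟨s, hs⟩ := IsAlgClosed.exists_pow_nat_eq (b ^ 2 - 4 * d * a) two_pos
  refine ⟨(-b + s) / (2 * d), (-b - s) / (2 * d), fun z => ?_⟩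
  field_simp
  linear_combination hs

/-- The sum of squared deviations from the mean. -/
theorem sum_sub_mean_sq {n : ℕ} (c : Fin n → ℂ) {m : ℂ} (hm : ∑ i, c i = n * m) :
    ∑ i, (c i - m) ^ 2 = ∑ i, c i ^ 2 - n * m ^ 2 := by
  have : ∀ i, (c i - m) ^ 2 = c i ^ 2 - 2 * m * c i + m ^ 2 := fun i => by ring
  simp only [this, Finset.sum_add_distrib, Finset.sum_sub_distrib, ← Finset.mul_sum, hm]
  simp
  ring

theorem sum_sq_lt_sq_sum {n : ℕ} (hn : 2 ≤ n) {x : Fin n → ℝ} (hx : ∀ i, 0 < x i) :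
    ∑ i, x i ^ 2 < (∑ i, x i) ^ 2 := by
  have hlt : ∀ i, x i < ∑ j, x j := fun i => by
    have : Nontrivial (Fin n) := Fin.nontrivial_iff_two_le.mpr hn
    obtain ⟨j, hj⟩ := exists_ne i
    exact Finset.single_lt_sum hj (Finset.mem_univ i) (Finset.mem_univ j) (hx j)
      fun k _ _ => (hx k).le
  rw [pow_two, Finset.sum_mul]
  refine Finset.sum_lt_sum_of_nonempty ⟨⟨0, by omega⟩, Finset.mem_univ _⟩ fun i _ => ?_
  rw [pow_two]
  exact mul_lt_mul_of_pos_left (hlt i) (hx i)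

/-- For points in an open half plane, `|v| + Re v` of the normalised squared deviation `v` from the
mean is smaller than twice the squared distance of the mean from the boundary. -/
theorem norm_add_re_deviation_lt {n : ℕ} (hn : 2 ≤ n) {h : ℝ} {c : Fin n → ℂ}
    (hc : ∀ i, h < (c i).re) {m : ℂ} (hm : ∑ i, c i = n * m) :
    ‖∑ i, (c i - m) ^ 2‖ + (∑ i, (c i - m) ^ 2).re < 2 * (n * (n - 1) * (m.re - h) ^ 2) := by
  -- `|v| + Re v` is subadditive and equals `2 (Re a)²` at `v = a²`.
  have h1 : ‖∑ i, (c i - m) ^ 2‖ + (∑ i, (c i - m) ^ 2).re ≤ ∑ i, 2 * ((c i).re - m.re) ^ 2 := by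
    calc _ ≤ ∑ i, ‖(c i - m) ^ 2‖ + ∑ i, ((c i - m) ^ 2).re := by
          rw [Complex.re_sum]
          gcongr
          exact norm_sum_le _ _
      _ = _ := by
          rw [← Finset.sum_add_distrib]
          exact Finset.sum_congr rfl fun i _ => by rw [norm_sq_add_re_sq, Complex.sub_re]
  have hre : ∑ i, (c i).re = n * m.re := by
    rw [← Complex.re_sum, hm]; simp
  have hs : ∑ i, ((c i).re - h) = n * (m.re - h) := by
    rw [Finset.sum_sub_distrib, hre]; simp; ring
  have h2 := sum_sq_lt_sq_sum hn fun i => sub_pos.mpr (hc i)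
  have h3 : ∑ i, ((c i).re - m.re) ^ 2 = ∑ i, ((c i).re - h) ^ 2 - n * (m.re - h) ^ 2 := by
    have : ∀ i, ((c i).re - m.re) ^ 2 =
        ((c i).re - h) ^ 2 - 2 * (m.re - h) * ((c i).re - h) + (m.re - h) ^ 2 := fun i => by ring
    simp only [this, Finset.sum_add_distrib, Finset.sum_sub_distrib, ← Finset.mul_sum, hs]
    simp
    ring
  rw [hs] at h2
  rw [← Finset.mul_sum, h3] at h1
  nlinarith

/-- The Grace–Walsh–Szegő coincidence theorem for half planes and symmetric multiaffine forms of
degree at most two, written in power sums. -/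
theorem symmetric_form_ne_zero {n : ℕ} (hn : 1 ≤ n) {a b d : ℂ} {h : ℝ}
    (hU : ∀ z : ℂ, h < z.re → a + b * n * z + d * (n * (n - 1) / 2) * z ^ 2 ≠ 0)
    {c : Fin n → ℂ} (hc : ∀ i, h < (c i).re) :
    a + b * ∑ i, c i + d * (((∑ i, c i) ^ 2 - ∑ i, c i ^ 2) / 2) ≠ 0 := by
  have hn0 : (n : ℂ) ≠ 0 := by exact_mod_cast (by omega : n ≠ 0)
  have hnpos : (0 : ℝ) < n := by exact_mod_cast hn
  obtain ⟨m, hm⟩ : ∃ m : ℂ, ∑ i, c i = n * m := ⟨(∑ i, c i) / n, by field_simp⟩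
  have hmre : h < m.re := by
    have h1 : ∑ i : Fin n, h < ∑ i, (c i).re :=
      Finset.sum_lt_sum_of_nonempty ⟨⟨0, hn⟩, Finset.mem_univ _⟩ fun i _ => hc i
    rw [← Complex.re_sum, hm] at h1
    simp only [Finset.sum_const, Finset.card_univ, Fintype.card_fin, nsmul_eq_mul,
      Complex.mul_re, Complex.natCast_re, Complex.natCast_im, zero_mul, sub_zero] at h1
    exact lt_of_mul_lt_mul_left h1 hnpos.le
  have hdev := sum_sub_mean_sq c hm
  intro h0
  -- Without a quadratic term (`d = 0` or `n = 1`) the form is the diagonal polynomial at the mean.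
  by_cases hd : d * (n * (n - 1) / 2) = 0
  · have hz : d * (((∑ i, c i) ^ 2 - ∑ i, c i ^ 2) / 2) = 0 := by
      rcases hn.eq_or_lt with rfl | hn2
      · simp
      · have : (n : ℂ) - 1 ≠ 0 := by
          rw [sub_ne_zero]; exact_mod_cast (by omega : n ≠ 1)
        have : d = 0 := by simpa [hn0, this] using hd
        simp [this]
    refine hU m hmre ?_
    rw [hz, hm] at h0
    rw [hd]
    linear_combination h0
  · have hn2 : 2 ≤ n := by
      by_contra hlt
      obtain rfl : n = 1 := by omega
      simp at hd
    obtain ⟨p, q, hpq⟩ := exists_quadratic_factorization (a := a) (b := b * n) hd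
    have hp : p.re ≤ h := by
      by_contra! hlt
      exact hU p hlt (by rw [hpq]; simp)
    have hq : q.re ≤ h := by
      by_contra! hlt
      exact hU q hlt (by rw [hpq]; simp)
    have hd0 : d ≠ 0 := left_ne_zero_of_mul hd
    -- Vanishing of the form fixes the deviation in terms of `p` and `q`, which lie outside the open
    -- half plane; this makes it too large for `norm_add_re_deviation_lt`.
    have hv : ∑ i, (c i - m) ^ 2 = (n * (n - 1) : ℝ) * ((m - p) * (m - q)) := by
      have e := hpq m
      rw [hm] at h0
      rw [hdev]
      push_cast
      refine mul_left_cancel₀ hd0 ?_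
      linear_combination 2 * e - 2 * h0
    have hlt := norm_add_re_deviation_lt hn2 hc hm
    have hNN : (0 : ℝ) < n * (n - 1) := by
      have : (2 : ℝ) ≤ n := by exact_mod_cast hn2
      exact mul_pos hnpos (by linarith)
    rw [hv, norm_mul, Complex.re_ofReal_mul, Complex.norm_real, Real.norm_of_nonneg hNN.le] at hlt
    have h2 := two_mul_re_mul_re_le (m - p) (m - q)
    have h3 : (m.re - h) ^ 2 ≤ (m - p).re * (m - q).re := by
      rw [Complex.sub_re, Complex.sub_re, pow_two]
      exact mul_le_mul (by linarith) (by linarith) (by linarith) (by linarith)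
    nlinarith

/-! ### Non-vanishing of `B[Q]` on the unit circle -/

/-- A complex polynomial of degree `n`, written with its `n` roots. -/
theorem exists_eq_prod_roots {n : ℕ} {Q : ℂ[X]} (hQ : Q.natDegree = n) :
    ∃ w : Fin n → ℂ, Q = C Q.leadingCoeff * ∏ i, (X - C (w i)) := by
  obtain ⟨l, hl⟩ := Quot.exists_rep Q.roots
  replace hl : (l : Multiset ℂ) = Q.roots := hl
  have hs := IsAlgClosed.splits Q
  have hlen : l.length = n := by
    rw [← hQ, hs.natDegree_eq_card_roots, ← hl, Multiset.coe_card]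
  subst hlen
  refine ⟨l.get, ?_⟩
  conv_lhs => rw [hs.eq_prod_roots, ← hl, Multiset.map_coe, Multiset.prod_coe]
  congr 1
  rw [← List.prod_ofFn]
  congr 1
  apply List.ext_getElem <;> simp

theorem eval_derivatives_prod {ι : Type*} (s : Finset ι) (w : ι → ℂ) {z : ℂ}
    (hz : ∀ i ∈ s, z - w i ≠ 0) :
    (derivative (∏ i ∈ s, (X - C (w i)))).eval z
        = (∏ i ∈ s, (X - C (w i))).eval z * ∑ i ∈ s, (z - w i)⁻¹ ∧
      (derivative (derivative (∏ i ∈ s, (X - C (w i))))).eval z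
        = (∏ i ∈ s, (X - C (w i))).eval z *
          ((∑ i ∈ s, (z - w i)⁻¹) ^ 2 - ∑ i ∈ s, (z - w i)⁻¹ ^ 2) := by
  classical
  induction s using Finset.induction_on with
  | empty => simp
  | insert a s ha ih =>
    obtain ⟨h1, h2⟩ := ih fun i hi => hz i (Finset.mem_insert_of_mem hi)
    have h0 := hz a (Finset.mem_insert_self a s)
    simp only [Finset.prod_insert ha, Finset.sum_insert ha, derivative_mul, derivative_add,
      derivative_sub, derivative_X, derivative_C, sub_zero, one_mul, eval_add, eval_mul, eval_sub,
      eval_X, eval_C, h1, h2]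
    constructor
    · field_simp
    · field_simp
      ring

/-- The Möbius map `w ↦ z / (z - w)` carries the disc `|w| < |z|` to this half plane. -/
theorem half_lt_re_div {z w : ℂ} (h : ‖w‖ < ‖z‖) : 1 / 2 < (z / (z - w)).re := by
  have hne : z - w ≠ 0 := sub_ne_zero.mpr fun e => by simp [e] at h
  have hpos : 0 < Complex.normSq (z - w) := Complex.normSq_pos.mpr hne
  have h2 : Complex.normSq w < Complex.normSq z := by
    rw [← Complex.sq_norm, ← Complex.sq_norm]
    exact pow_lt_pow_left₀ h (norm_nonneg _) two_ne_zero
  rw [Complex.div_re, ← add_div, div_lt_div_iff₀ two_pos hpos]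
  simp only [Complex.normSq_apply, Complex.sub_re, Complex.sub_im] at *
  nlinarith

theorem eval_rahmanOp (n : ℕ) (l₀ l₁ l₂ : ℂ) (P : ℂ[X]) (z : ℂ) :
    (rahmanOp n l₀ l₁ l₂ P).eval z = l₀ * P.eval z + l₁ * (n / 2 * z) * (derivative P).eval z
      + l₂ * (n / 2 * z) ^ 2 * (1 / 2 * (derivative (derivative P)).eval z) := by
  simp [rahmanOp]

/-- The operators of Rahman type do not vanish on `|z| = 1` at polynomials of exact degree `n` with
all zeros in the open unit disc. -/
theorem eval_rahmanOp_ne_zero {n : ℕ} (hn : 1 ≤ n) {l₀ l₁ l₂ : ℂ}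
    (hU : ∀ z : ℂ, rahmanChar n l₀ l₁ l₂ z = 0 → ‖z‖ ≤ ‖z - (n : ℂ) / 2‖)
    {Q : ℂ[X]} (hdeg : Q.natDegree = n) (hQ : ∀ w : ℂ, 1 ≤ ‖w‖ → Q.eval w ≠ 0)
    {z : ℂ} (hz : ‖z‖ = 1) : (rahmanOp n l₀ l₁ l₂ Q).eval z ≠ 0 := by
  obtain ⟨w, hw⟩ := exists_eq_prod_roots hdeg
  have hw1 : ∀ i, ‖w i‖ < ‖z‖ := fun i => by
    by_contra! hle
    refine hQ (w i) (hz ▸ hle) ?_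
    rw [hw, eval_mul, eval_prod, Finset.prod_eq_zero (Finset.mem_univ i) (by simp), mul_zero]
  have hQz := hQ z hz.ge
  have hne : ∀ i, z - w i ≠ 0 := fun i => sub_ne_zero.mpr fun e => by simpa [e] using hw1 i
  obtain ⟨h1, h2⟩ := eval_derivatives_prod Finset.univ w fun i _ => hne i
  have hd1 : (derivative Q).eval z = Q.eval z * ∑ i, (z - w i)⁻¹ := by
    rw [hw, derivative_C_mul, eval_mul, h1, eval_mul, mul_assoc]
  have hd2 : (derivative (derivative Q)).eval z
      = Q.eval z * ((∑ i, (z - w i)⁻¹) ^ 2 - ∑ i, (z - w i)⁻¹ ^ 2) := by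
    rw [hw, derivative_C_mul, derivative_C_mul, eval_mul, h2, eval_mul, mul_assoc]
  have hchar : ∀ c : ℂ, (1 / 2 : ℝ) < c.re →
      l₀ + l₁ * (n / 2) * n * c + l₂ * (n / 2) ^ 2 * (n * (n - 1) / 2) * c ^ 2 ≠ 0 := by
    intro c hc h0
    -- At `n c / 2` the zero condition on `U` reads `|c| ≤ |c - 1|`, that is `Re c ≤ 1 / 2`.
    have hle := hU (n / 2 * c) (by rw [rahmanChar, ← h0]; ring)
    rw [show (n : ℂ) / 2 * c - n / 2 = n / 2 * (c - 1) by ring, norm_mul, norm_mul] at hle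
    have hnn : 0 < ‖(n : ℂ) / 2‖ := by
      rw [norm_pos_iff]
      exact div_ne_zero (by exact_mod_cast (by omega : n ≠ 0)) two_ne_zero
    have hle' := pow_le_pow_left₀ (norm_nonneg _) (le_of_mul_le_mul_left hle hnn) 2
    rw [Complex.sq_norm, Complex.sq_norm, Complex.normSq_apply, Complex.normSq_apply] at hle'
    simp only [Complex.sub_re, Complex.sub_im, Complex.one_re, Complex.one_im] at hle'
    nlinarith
  have key := symmetric_form_ne_zero hn hchar fun i => half_lt_re_div (hw1 i)
  have hs1 : ∑ i, z / (z - w i) = z * ∑ i, (z - w i)⁻¹ := by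
    simp only [div_eq_mul_inv, Finset.mul_sum]
  have hs2 : ∑ i, (z / (z - w i)) ^ 2 = z ^ 2 * ∑ i, (z - w i)⁻¹ ^ 2 := by
    simp only [div_eq_mul_inv, mul_pow, Finset.mul_sum]
  rw [hs1, hs2] at key
  rw [eval_rahmanOp, hd1, hd2]
  convert mul_ne_zero hQz key using 1
  ring

/-! ### Comparing two dilations; the size of `Φ` -/

theorem dilated_factor_lt {k r R : ℝ} (hk : 0 < k) (hkr : k ≤ r) (hrR : r < R) {z w : ℂ}
    (hz : 1 ≤ ‖z‖) (hw : ‖w‖ < k) :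
    (R + k) / (k + r) * ‖r * z - w‖ < ‖R * z - w‖ := by
  have hr : 0 < r := hk.trans_le hkr
  have expand : ∀ t : ℝ, ‖t * z - w‖ ^ 2 =
      t ^ 2 * ‖z‖ ^ 2 - 2 * t * (z * (starRingEnd ℂ) w).re + ‖w‖ ^ 2 := by
    intro t
    simp only [Complex.sq_norm, Complex.normSq_apply, Complex.sub_re, Complex.sub_im,
      Complex.mul_re, Complex.mul_im, Complex.ofReal_re, Complex.ofReal_im, Complex.conj_re,
      Complex.conj_im]
    ring
  have ht : -(‖z‖ * ‖w‖) ≤ (z * (starRingEnd ℂ) w).re := by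
    have := (abs_le.mp (Complex.abs_re_le_norm (z * (starRingEnd ℂ) w))).1
    rwa [norm_mul, Complex.norm_conj] at this
  rw [div_mul_eq_mul_div, div_lt_iff₀ (by linarith)]
  refine lt_of_pow_lt_pow_left₀ 2 (by positivity) ?_
  rw [mul_pow, mul_pow, expand, expand]
  generalize (z * (starRingEnd ℂ) w).re = t at ht
  have hy : 0 ≤ ‖w‖ := norm_nonneg w
  generalize ‖w‖ = y at *
  generalize ‖z‖ = x at *
  -- The difference of squares is affine in `t` with slope `2 (R - r) (R r - k²) ≥ 0`, so the worst
  -- case is `t = -x y`, where it factors as `(R - r)` times the product in `e2`.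
  have hyx : y < k * x := by nlinarith
  have hRk : 0 ≤ R * r - k ^ 2 := by nlinarith
  have e1 : 0 ≤ (t + x * y) * (R * r - k ^ 2) := mul_nonneg (by linarith) hRk
  have e2 : 0 < (k * x - y) * (k * x * (R + r + 2 * k) + y * (R + r + 2 * k)
      + 2 * x * (R * r - k ^ 2)) := by
    apply mul_pos (by linarith)
    have : 0 < k * x * (R + r + 2 * k) := by
      apply mul_pos (mul_pos hk (by linarith)) (by linarith)
    have : 0 ≤ y * (R + r + 2 * k) := mul_nonneg hy (by linarith)
    have : 0 ≤ 2 * x * (R * r - k ^ 2) := mul_nonneg (by linarith) hRk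
    linarith
  have e3 := mul_pos (sub_pos.mpr hrR) (add_pos_of_nonneg_of_pos (mul_nonneg two_pos.le e1) e2)
  nlinarith

theorem norm_eval_dilated_lt {n : ℕ} (hn : 1 ≤ n) {k r R : ℝ} (hk : 0 < k) (hkr : k ≤ r)
    (hrR : r < R) {H : ℂ[X]} (hdeg : H.natDegree = n) (hH : ∀ w : ℂ, k ≤ ‖w‖ → H.eval w ≠ 0)
    {z : ℂ} (hz : 1 ≤ ‖z‖) :
    ((R + k) / (k + r)) ^ n * ‖H.eval (r * z)‖ < ‖H.eval (R * z)‖ := by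
  obtain ⟨w, hw⟩ := exists_eq_prod_roots hdeg
  have hr : 0 < r := hk.trans_le hkr
  have hw1 : ∀ i, ‖w i‖ < k := fun i => by
    by_contra! hle
    refine hH (w i) hle ?_
    rw [hw, eval_mul, eval_prod, Finset.prod_eq_zero (Finset.mem_univ i) (by simp), mul_zero]
  have hlc : 0 < ‖H.leadingCoeff‖ := by
    rw [norm_pos_iff, leadingCoeff_ne_zero]
    rintro rfl
    simp at hdeg
    omega
  have hev : ∀ t : ℝ, ‖H.eval (t * z)‖ = ‖H.leadingCoeff‖ * ∏ i, ‖t * z - w i‖ := fun t => by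
    conv_lhs => rw [hw]
    simp [eval_prod]
  rw [hev, hev, mul_left_comm]
  refine mul_lt_mul_of_pos_left ?_ hlc
  rw [← Fin.prod_const, ← Finset.prod_mul_distrib]
  refine Finset.prod_lt_prod_of_nonempty (fun i _ => ?_)
    (fun i _ => dilated_factor_lt hk hkr hrR hz (hw1 i)) ⟨⟨0, hn⟩, Finset.mem_univ _⟩
  have : (r : ℂ) * z - w i ≠ 0 := sub_ne_zero.mpr fun e => by
    have h1 := hw1 i
    rw [← e, norm_mul, Complex.norm_real, Real.norm_of_nonneg hr.le] at h1
    nlinarith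
  have := norm_pos_iff.mpr this
  have : 0 < (R + k) / (k + r) := div_pos (by linarith) (by linarith)
  positivity

theorem norm_bigPhi_le (n : ℕ) {k r R : ℝ} (hk : 0 < k) (hkr : k ≤ r) (hrR : r < R) {α β : ℂ}
    (hα : ‖α‖ ≤ 1) (hβ : ‖β‖ ≤ 1) : ‖bigPhi n k R r α β‖ ≤ ((R + k) / (k + r)) ^ n := by
  have h1 : 1 ≤ ((R + k) / (k + r)) ^ n :=
    one_le_pow₀ ((one_le_div (by linarith)).mpr (by linarith))
  refine (norm_sub_le _ _).trans ?_
  rw [norm_mul, Complex.norm_real, Real.norm_of_nonneg (by linarith)]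
  nlinarith [norm_nonneg β]

/-- `r (R + k) < R (k + r)` gives `rⁿ |Φ| < Rⁿ`; this keeps both `deg G = n` and `K ≠ 0`. -/
theorem pow_add_pow_mul_bigPhi_ne_zero {n : ℕ} (hn : 1 ≤ n) {k r R : ℝ} (hk : 0 < k)
    (hkr : k ≤ r) (hrR : r < R) {α β : ℂ} (hα : ‖α‖ ≤ 1) (hβ : ‖β‖ ≤ 1) :
    (R : ℂ) ^ n + (r : ℂ) ^ n * bigPhi n k R r α β ≠ 0 := by
  intro h0
  have hr : 0 < r := hk.trans_le hkr
  have hR : 0 < R := hr.trans hrR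
  have h1 : ‖(R : ℂ) ^ n‖ = ‖(r : ℂ) ^ n * bigPhi n k R r α β‖ := by
    rw [eq_neg_of_add_eq_zero_left h0, norm_neg]
  rw [norm_mul, norm_pow, norm_pow, Complex.norm_real, Complex.norm_real,
    Real.norm_of_nonneg hr.le, Real.norm_of_nonneg hR.le] at h1
  have h2 : R ^ n ≤ (r * ((R + k) / (k + r))) ^ n := by
    rw [h1, mul_pow]
    exact mul_le_mul_of_nonneg_left (norm_bigPhi_le n hk hkr hrR hα hβ) (by positivity)
  have h3 : r * ((R + k) / (k + r)) < R := by
    rw [← mul_div_assoc, div_lt_iff₀ (by linarith)]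
    nlinarith
  have h4 : 0 ≤ r * ((R + k) / (k + r)) :=
    mul_nonneg hr.le (div_nonneg (by linarith) (by linarith))
  exact absurd h2 (not_le.mpr (pow_lt_pow_left₀ h3 h4 (by omega)))

/-! ### Growth outside the circle of radius `k` -/

theorem norm_eval_le_maxModulus (P : ℂ[X]) {k : ℝ} (hk : 0 ≤ k) {z : ℂ} (hz : ‖z‖ = k) :
    ‖P.eval z‖ ≤ maxModulus P k :=
  (isGreatest_maxModulus P hk).2 ⟨z, by simpa using hz, rfl⟩

theorem eval_eq_pow_mul_eval_reflect {n : ℕ} {P : ℂ[X]} (hP : P.natDegree ≤ n) {z : ℂ}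
    (hz : z ≠ 0) : P.eval z = z ^ n * (reflect n P).eval z⁻¹ := by
  let _ := invertibleOfNonzero hz
  have h := eval₂_reflect_mul_pow (RingHom.id ℂ) z n P hP
  rw [invOf_eq_inv] at h
  rw [mul_comm]
  exact h.symm

/-- Maximum principle for `wⁿ P(1 / w)`: it controls `P` on `|z| ≥ k` and, at `w = 0`, the
coefficient of `zⁿ`. -/
theorem norm_eval_reflect_le {n : ℕ} {P : ℂ[X]} (hP : P.natDegree ≤ n) {k : ℝ} (hk : 0 < k)
    {w : ℂ} (hw : ‖w‖ ≤ k⁻¹) : ‖(reflect n P).eval w‖ ≤ maxModulus P k / k ^ n := by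
  refine Complex.norm_le_of_forall_mem_frontier_norm_le (U := Metric.ball (0 : ℂ) k⁻¹)
    Metric.isBounded_ball (reflect n P).differentiable.diffContOnCl ?_ ?_
  · intro u hu
    rw [frontier_ball _ (inv_ne_zero hk.ne'), mem_sphere_zero_iff_norm] at hu
    have hu0 : u⁻¹ ≠ 0 := inv_ne_zero (norm_ne_zero_iff.mp (hu ▸ inv_ne_zero hk.ne'))
    have hnorm : ‖u⁻¹‖ = k := by rw [norm_inv, hu, inv_inv]
    have h := norm_eval_le_maxModulus P hk.le hnorm
    rw [eval_eq_pow_mul_eval_reflect hP hu0, inv_inv, norm_mul, norm_pow, hnorm] at h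
    rwa [le_div_iff₀ (by positivity), mul_comm]
  · rw [closure_ball _ (inv_ne_zero hk.ne')]
    simpa using hw

theorem norm_eval_le_of_le_norm {n : ℕ} {P : ℂ[X]} (hP : P.natDegree ≤ n) {k : ℝ} (hk : 0 < k)
    {z : ℂ} (hz : k ≤ ‖z‖) : ‖P.eval z‖ ≤ maxModulus P k / k ^ n * ‖z‖ ^ n := by
  have hz0 : z ≠ 0 := norm_pos_iff.mp (hk.trans_le hz)
  rw [eval_eq_pow_mul_eval_reflect hP hz0, norm_mul, norm_pow, mul_comm]
  refine mul_le_mul_of_nonneg_right (norm_eval_reflect_le hP hk ?_) (by positivity)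
  rw [norm_inv]
  exact inv_anti₀ hk hz

theorem norm_coeff_le {n : ℕ} {P : ℂ[X]} (hP : P.natDegree ≤ n) {k : ℝ} (hk : 0 < k) :
    ‖P.coeff n‖ ≤ maxModulus P k / k ^ n := by
  have h := norm_eval_reflect_le hP hk (w := 0) (by simpa using hk.le)
  rwa [← coeff_zero_eq_eval_zero, coeff_reflect, revAt_le (Nat.zero_le n), Nat.sub_zero] at h

/-! ### Dilations, linearity of `B`, and the comparison argument -/

theorem eval_dilate (P : ℂ[X]) (t : ℝ) (z : ℂ) : (dilate P t).eval z = P.eval (t * z) := by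
  simp [dilate]

theorem natDegree_dilate_le (P : ℂ[X]) (t : ℝ) : (dilate P t).natDegree ≤ P.natDegree := by
  refine natDegree_comp_le.trans ?_
  exact (Nat.mul_le_mul_left _ ((natDegree_C_mul_le _ _).trans natDegree_X_le)).trans (by simp)

theorem coeff_dilate (P : ℂ[X]) (t : ℝ) (j : ℕ) : (dilate P t).coeff j = P.coeff j * t ^ j := by
  rw [dilate, comp_C_mul_X_coeff]

theorem dilate_sub (P Q : ℂ[X]) (t : ℝ) : dilate (P - Q) t = dilate P t - dilate Q t := by
  simp [dilate]

theorem dilate_C_mul_X_pow (a : ℂ) (n : ℕ) (t : ℝ) :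
    dilate (C a * X ^ n) t = C (a * t ^ n) * X ^ n := by
  simp [dilate, mul_pow, mul_assoc]

theorem rahmanOp_add (n : ℕ) (l₀ l₁ l₂ : ℂ) (P Q : ℂ[X]) :
    rahmanOp n l₀ l₁ l₂ (P + Q) = rahmanOp n l₀ l₁ l₂ P + rahmanOp n l₀ l₁ l₂ Q := by
  simp only [rahmanOp, derivative_add]
  ring

theorem rahmanOp_C_mul (n : ℕ) (l₀ l₁ l₂ a : ℂ) (P : ℂ[X]) :
    rahmanOp n l₀ l₁ l₂ (C a * P) = C a * rahmanOp n l₀ l₁ l₂ P := by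
  simp only [rahmanOp, derivative_C_mul]
  ring

theorem rahmanOp_sub (n : ℕ) (l₀ l₁ l₂ : ℂ) (P Q : ℂ[X]) :
    rahmanOp n l₀ l₁ l₂ (P - Q) = rahmanOp n l₀ l₁ l₂ P - rahmanOp n l₀ l₁ l₂ Q := by
  simp only [rahmanOp, derivative_sub]
  ring

/-- If `H` has exact degree `n` and all its zeros in `|z| < k`, then the image under `B` of
`H(R z) + Φ H(r z)` does not vanish on `|z| = 1`. -/
theorem eval_rahmanOp_dilate_add_ne_zero {n : ℕ} (hn : 1 ≤ n) {l₀ l₁ l₂ : ℂ}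
    (hU : ∀ z : ℂ, rahmanChar n l₀ l₁ l₂ z = 0 → ‖z‖ ≤ ‖z - (n : ℂ) / 2‖)
    {α β : ℂ} (hα : ‖α‖ ≤ 1) (hβ : ‖β‖ ≤ 1) {k r R : ℝ} (hk : 0 < k) (hkr : k ≤ r) (hrR : r < R)
    {H : ℂ[X]} (hdeg : H.natDegree = n) (hH : ∀ w : ℂ, k ≤ ‖w‖ → H.eval w ≠ 0)
    {z : ℂ} (hz : ‖z‖ = 1) :
    (rahmanOp n l₀ l₁ l₂ (dilate H R)).eval z
      + bigPhi n k R r α β * (rahmanOp n l₀ l₁ l₂ (dilate H r)).eval z ≠ 0 := by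
  set Φ := bigPhi n k R r α β with hΦ
  set G := dilate H R + C Φ * dilate H r with hG
  have hH0 : H ≠ 0 := by
    rintro rfl
    simp at hdeg
    omega
  have hcoeff : G.coeff n ≠ 0 := by
    have h1 : G.coeff n = H.coeff n * ((R : ℂ) ^ n + (r : ℂ) ^ n * Φ) := by
      rw [hG, coeff_add, coeff_C_mul, coeff_dilate, coeff_dilate]
      ring
    rw [h1, ← hdeg]
    refine mul_ne_zero (leadingCoeff_ne_zero.mpr hH0) ?_
    rw [hdeg]
    exact pow_add_pow_mul_bigPhi_ne_zero hn hk hkr hrR hα hβ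
  have hGdeg : G.natDegree = n := by
    refine le_antisymm ?_ (le_natDegree_of_ne_zero hcoeff)
    refine natDegree_add_le_of_degree_le ((natDegree_dilate_le H R).trans hdeg.le) ?_
    exact (natDegree_C_mul_le _ _).trans ((natDegree_dilate_le H r).trans hdeg.le)
  have hGne : ∀ w : ℂ, 1 ≤ ‖w‖ → G.eval w ≠ 0 := by
    intro w hw h0
    rw [hG, eval_add, eval_mul, eval_C, eval_dilate, eval_dilate] at h0
    have h1 := norm_eval_dilated_lt hn hk hkr hrR hdeg hH hw
    rw [eq_neg_of_add_eq_zero_left h0, norm_neg, norm_mul] at h1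
    exact absurd h1 (not_lt.mpr (mul_le_mul_of_nonneg_right
      (norm_bigPhi_le n hk hkr hrR hα hβ) (norm_nonneg _)))
  have := eval_rahmanOp_ne_zero hn hU hGdeg hGne hz
  rwa [hG, rahmanOp_add, rahmanOp_C_mul, eval_add, eval_mul, eval_C] at this

theorem eval_rahmanOp_X_pow_ne_zero {n : ℕ} (hn : 1 ≤ n) {l₀ l₁ l₂ : ℂ}
    (hU : ∀ z : ℂ, rahmanChar n l₀ l₁ l₂ z = 0 → ‖z‖ ≤ ‖z - (n : ℂ) / 2‖)
    {z : ℂ} (hz : ‖z‖ = 1) : (rahmanOp n l₀ l₁ l₂ (X ^ n)).eval z ≠ 0 := by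
  refine eval_rahmanOp_ne_zero hn hU (natDegree_X_pow n) (fun w hw => ?_) hz
  rw [eval_pow, eval_X]
  exact pow_ne_zero _ (norm_pos_iff.mp (one_pos.trans_le hw))

theorem eval_rahmanOp_dilate_monomial (n : ℕ) (l₀ l₁ l₂ a Φ z : ℂ) (r R : ℝ) :
    (rahmanOp n l₀ l₁ l₂ (dilate (C a * X ^ n) R)).eval z
        + Φ * (rahmanOp n l₀ l₁ l₂ (dilate (C a * X ^ n) r)).eval z
      = a * (((R : ℂ) ^ n + (r : ℂ) ^ n * Φ) * (rahmanOp n l₀ l₁ l₂ (X ^ n)).eval z) := by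
  rw [dilate_C_mul_X_pow, dilate_C_mul_X_pow, rahmanOp_C_mul, rahmanOp_C_mul, eval_mul, eval_mul,
    eval_C, eval_C]
  ring

theorem maxModulus_C_mul_X_pow (a : ℂ) (n : ℕ) {k : ℝ} (hk : 0 ≤ k) :
    maxModulus (C a * X ^ n) k = ‖a‖ * k ^ n := by
  obtain ⟨z, hz, h⟩ := (isGreatest_maxModulus (C a * X ^ n) hk).1
  rw [← h]
  simp_all

/-- The Bernstein-type inequality for operators of Rahman type, in degree `n ≥ 1`. -/
theorem norm_eval_rahmanOp_dilate_add_le {n : ℕ} (hn : 1 ≤ n) {l₀ l₁ l₂ : ℂ}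
    (hU : ∀ z : ℂ, rahmanChar n l₀ l₁ l₂ z = 0 → ‖z‖ ≤ ‖z - (n : ℂ) / 2‖)
    {α β : ℂ} (hα : ‖α‖ ≤ 1) (hβ : ‖β‖ ≤ 1) {k r R : ℝ} (hk : 0 < k) (hkr : k ≤ r) (hrR : r < R)
    {P : ℂ[X]} (hP : P.natDegree ≤ n) {z : ℂ} (hz : ‖z‖ = 1) :
    ‖(rahmanOp n l₀ l₁ l₂ (dilate P R)).eval z
        + bigPhi n k R r α β * (rahmanOp n l₀ l₁ l₂ (dilate P r)).eval z‖
      ≤ maxModulus P k / k ^ n * ‖((R : ℂ) ^ n + (r : ℂ) ^ n * bigPhi n k R r α β)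
          * (rahmanOp n l₀ l₁ l₂ (X ^ n)).eval z‖ := by
  set Φ := bigPhi n k R r α β with hΦ
  set K := ((R : ℂ) ^ n + (r : ℂ) ^ n * Φ) * (rahmanOp n l₀ l₁ l₂ (X ^ n)).eval z with hK
  have hK0 : K ≠ 0 := mul_ne_zero (pow_add_pow_mul_bigPhi_ne_zero hn hk hkr hrR hα hβ)
    (eval_rahmanOp_X_pow_ne_zero hn hU hz)
  set T := (rahmanOp n l₀ l₁ l₂ (dilate P R)).eval z
    + Φ * (rahmanOp n l₀ l₁ l₂ (dilate P r)).eval z with hT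
  by_contra! hlt
  have hμ : maxModulus P k / k ^ n < ‖T / K‖ := by
    rwa [norm_div, lt_div_iff₀ (norm_pos_iff.mpr hK0)]
  set μ := T / K with hμT
  set H := P - C μ * X ^ n with hH
  have hcoeff : H.coeff n ≠ 0 := by
    rw [hH, coeff_sub, coeff_C_mul, coeff_X_pow_self, mul_one, sub_ne_zero]
    intro h
    exact absurd (norm_coeff_le hP hk) (not_le.mpr (h ▸ hμ))
  have hdeg : H.natDegree = n := by
    refine le_antisymm ?_ (le_natDegree_of_ne_zero hcoeff)
    exact (natDegree_sub_le _ _).trans (max_le hP (natDegree_C_mul_X_pow_le _ _))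
  have hne : ∀ w : ℂ, k ≤ ‖w‖ → H.eval w ≠ 0 := by
    intro w hw h0
    rw [hH, eval_sub, sub_eq_zero] at h0
    have h1 := norm_eval_le_of_le_norm hP hk hw
    rw [h0, eval_mul, eval_C, eval_pow, eval_X, norm_mul, norm_pow] at h1
    exact absurd (le_of_mul_le_mul_right h1 (pow_pos (hk.trans_le hw) n)) (not_le.mpr hμ)
  refine eval_rahmanOp_dilate_add_ne_zero hn hU hα hβ hk hkr hrR hdeg hne hz ?_
  have hmon := eval_rahmanOp_dilate_monomial n l₀ l₁ l₂ μ Φ z r R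
  rw [← hK, hμT, div_mul_cancel₀ _ hK0, ← hμT] at hmon
  rw [← hΦ, hH, dilate_sub, dilate_sub, rahmanOp_sub, rahmanOp_sub, eval_sub, eval_sub]
  linear_combination -hT - hmon

theorem corollary2p3 (n : ℕ) (B : ℂ[X] → ℂ[X]) (hB : B ∈ rahmanClass n)
    (α β : ℂ) (hα : ‖α‖ ≤ 1) (hβ : ‖β‖ ≤ 1)
    (k r R : ℝ) (hk : 0 < k) (hkr : k ≤ r) (hrR : r < R) :
    -- the inequality
    (∀ P : ℂ[X], P.natDegree ≤ n → ∀ z : ℂ, ‖z‖ = 1 →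
      ‖(B (dilate P R)).eval z + bigPhi n k R r α β * (B (dilate P r)).eval z‖
        ≤ 1 / k ^ n * ‖(R : ℂ) ^ n + (r : ℂ) ^ n * bigPhi n k R r α β‖
          * ‖(B (X ^ n)).eval z‖ * maxModulus P k) ∧
    -- equality for `P(z) = a zⁿ`
    (∀ a : ℂ, a ≠ 0 → ∀ z : ℂ, ‖z‖ = 1 →
      ‖(B (dilate (C a * X ^ n) R)).eval z
          + bigPhi n k R r α β * (B (dilate (C a * X ^ n) r)).eval z‖
        = 1 / k ^ n * ‖(R : ℂ) ^ n + (r : ℂ) ^ n * bigPhi n k R r α β‖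
          * ‖(B (X ^ n)).eval z‖ * maxModulus (C a * X ^ n) k) ∧
    -- no smaller constant will do
    (∀ z : ℂ, ‖z‖ = 1 → ∀ c : ℝ,
      (∀ P : ℂ[X], P.natDegree ≤ n →
        ‖(B (dilate P R)).eval z + bigPhi n k R r α β * (B (dilate P r)).eval z‖
          ≤ c * maxModulus P k) →
      1 / k ^ n * ‖(R : ℂ) ^ n + (r : ℂ) ^ n * bigPhi n k R r α β‖
          * ‖(B (X ^ n)).eval z‖ ≤ c) := by
  obtain ⟨l₀, l₁, l₂, hU, hBP⟩ := hB
  have hBd : ∀ (P : ℂ[X]) (t : ℝ), P.natDegree ≤ n →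
      B (dilate P t) = rahmanOp n l₀ l₁ l₂ (dilate P t) :=
    fun P t hP => hBP _ ((natDegree_dilate_le P t).trans hP)
  have hBX : B (X ^ n) = rahmanOp n l₀ l₁ l₂ (X ^ n) := hBP _ (natDegree_X_pow_le n)
  have hkn : k ^ n ≠ 0 := (pow_pos hk n).ne'
  have heq : ∀ a z : ℂ,
      ‖(B (dilate (C a * X ^ n) R)).eval z
          + bigPhi n k R r α β * (B (dilate (C a * X ^ n) r)).eval z‖
        = 1 / k ^ n * ‖(R : ℂ) ^ n + (r : ℂ) ^ n * bigPhi n k R r α β‖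
          * ‖(B (X ^ n)).eval z‖ * maxModulus (C a * X ^ n) k := by
    intro a z
    rw [hBd _ R (natDegree_C_mul_X_pow_le a n), hBd _ r (natDegree_C_mul_X_pow_le a n), hBX,
      eval_rahmanOp_dilate_monomial, maxModulus_C_mul_X_pow a n hk.le, norm_mul, norm_mul]
    field_simp
  refine ⟨fun P hP z hz => ?_, fun a _ z _ => heq a z, fun z _ c hc => ?_⟩
  -- For `n = 0` the factor `1 + Φ` may vanish, but constants are multiples of the extremal
  -- monomial.
  · rcases Nat.eq_zero_or_pos n with rfl | hn
    · rw [eq_C_of_natDegree_le_zero hP]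
      simpa using (heq (P.coeff 0) z).le
    · rw [hBd P R hP, hBd P r hP, hBX]
      refine (norm_eval_rahmanOp_dilate_add_le hn hU hα hβ hk hkr hrR hP hz).trans_eq ?_
      rw [norm_mul]
      ring
  · have h := hc (C 1 * X ^ n) (natDegree_C_mul_X_pow_le 1 n)
    rw [heq 1 z, maxModulus_C_mul_X_pow 1 n hk.le, norm_one, one_mul] at h
    exact le_of_mul_le_mul_right h (pow_pos hk n)
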